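/- All graphs are finite and simple. A connected graph $H$ is called $k$-cyclic if $|E(H)|-|V(H)|+1=k$. For integers $n\ge 1$ and $p,k\ge 0$, let $Q_pC^k(n)$ be the class of connected graphs $G$ with $n$ vertices such that $G\setminus S$ is $k$-cyclic for some $S\subseteq V(G)$ with $|S|=p$, while $G\setminus S'$ is $k$-cyclic for no $S'\subseteq V(G)$ with $|S'|<p$. Let $M_1(G)=\sum_{v\in V(G)}d(v)^2$ and $M_2(G)=\sum_{uv\in E(G)}d(u)d(v)$ be the first and second Zagreb indices, and let $G+H$ denote the join of $G$ and $H$, i.e. their disjoint union together with all edges between $V(G)$ and $V(H)$. Let $K_m$ be the complete graph and $S_m$ the star on $m$ vertices, and define the following graphs on $m$ vertices: - $U^3_m$ ($m\ge 3$): a triangle with $m-3$ pendant edges attached at one of its vertices; - $B^{3,3}_m$ ($m\ge 4$): two triangles sharing an edge, with $m-4$ pendant edges attached at one endpoint of the shared edge; - $K_m(m-3,1,1,1)$ ($m\ge 4$): the graph $K_4$ with $m-4$ pendant edges attached at one of its vertices; - $q_m(m-4,1,1,1,1)$ ($m\ge 5$): three triangles sharing one common edge, with $m-5$ pendant edges attached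 at one endpoint of the shared edge. Then the following hold. 1. If $n\ge p+2$, then $S_{n-p}+K_p\in Q_pC^0(n)$, and every $G\in Q_pC^0(n)$ satisfies $M_1(G)\le M_1(S_{n-p}+K_p)$ and $M_2(G)\le M_2(S_{n-p}+K_p)$. 2. If $n\ge p+3$, then $U^3_{n-p}+K_p\in Q_pC^1(n)$, and every $G\in Q_pC^1(n)$ satisfies $M_1(G)\le M_1(U^3_{n-p}+K_p)$ and $M_2(G)\le M_2(U^3_{n-p}+K_p)$. 3. If $n\ge p+4$, then $B^{3,3}_{n-p}+K_p\in Q_pC^2(n)$, and every $G\in Q_pC^2(n)$ satisfies $M_1(G)\le M_1(B^{3,3}_{n-p}+K_p)$ and $M_2(G)\le M_2(B^{3,3}_{n-p}+K_p)$. 4. If $n\ge p+5$, then $K_{n-p}(n-p-3,1,1,1)+K_p$ and $q_{n-p}(n-p-4,1,1,1,1)+K_p$ both belong to $Q_pC^3(n)$, and every $G\in Q_pC^3(n)$ satisfies $$M_1(G)\le M_1\bigl(K_{n-p}(n-p-3,1,1,1)+K_p\bigr)=M_1\bigl(q_{n-p}(n-p-4,1,1,1,1)+K_p\bigr)$$ and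 $M_2(G)\le M_2\bigl(K_{n-p}(n-p-3,1,1,1)+K_p\bigr)$. -/

import Mathlib

universe u

namespace ZagrebQuasi

/-- The first Zagreb index `∑_v d(v)²`. -/
noncomputable def firstZagreb {V : Type*} [Fintype V] (G : SimpleGraph V) : ℕ :=
  open Classical in ∑ v : V, G.degree v ^ 2

/-- The second Zagreb index `∑_{uv ∈ E(G)} d(u) d(v)`, each edge being counted once. -/
noncomputable def secondZagreb {V : Type*} [Fintype V] (G : SimpleGraph V) : ℕ :=
  open Classical in
  ∑ e ∈ G.edgeFinset,
    Sym2.lift ⟨fun x y => G.degree x * G.degree y, fun _ _ => Nat.mul_comm _ _⟩ e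

/-- The cyclomatic number `|E(G)| - |V(G)| + 1` of a finite (connected) graph. -/
noncomputable def cyclomaticNumber {V : Type*} (G : SimpleGraph V) : ℤ :=
  (G.edgeSet.ncard : ℤ) - (Nat.card V : ℤ) + 1

/-- A `k`-cyclic graph: connected (in particular nonempty) with cyclomatic number `k`. -/
def IsCyclicOfNumber {V : Type*} (k : ℕ) (G : SimpleGraph V) : Prop :=
  G.Connected ∧ cyclomaticNumber G = (k : ℤ)

/-- `G \ S`: the graph obtained from `G` by deleting the vertices in `S`. -/
def deleteVerts {V : Type*} (G : SimpleGraph V) (S : Finset V) :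
    SimpleGraph ((S : Set V)ᶜ : Set V) :=
  G.induce ((S : Set V)ᶜ)

/-- Membership in `Q_p C^k(n)`: `G` is a connected graph of order `n`, deleting some `p` vertices
leaves a `k`-cyclic graph, and deleting fewer than `p` vertices never does. -/
def MemQuasiCyclic {V : Type*} [Fintype V] (p k n : ℕ) (G : SimpleGraph V) : Prop :=
  Fintype.card V = n ∧ G.Connected ∧
    (∃ S : Finset V, S.card = p ∧ IsCyclicOfNumber k (deleteVerts G S)) ∧
    ∀ S' : Finset V, S'.card < p → ¬ IsCyclicOfNumber k (deleteVerts G S')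

/-- The join `G + H`: disjoint copies of `G` and `H`, together with all edges between them. -/
def join {V W : Type*} (G : SimpleGraph V) (H : SimpleGraph W) : SimpleGraph (V ⊕ W) :=
  (G ⊕g H) ⊔ completeBipartiteGraph V W

/-- `G + K_p`. -/
def joinComplete {V : Type*} (G : SimpleGraph V) (p : ℕ) : SimpleGraph (V ⊕ Fin p) :=
  join G (⊤ : SimpleGraph (Fin p))

/-- The graph obtained from `H` by attaching `r` pendant edges at the vertex `c`: the new vertices
are `Sum.inr i`, and each of them is adjacent to `Sum.inl c` only. -/
def attachPendants {V : Type*} (H : SimpleGraph V) (c : V) (r : ℕ) : SimpleGraph (V ⊕ Fin r) :=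
  (H ⊕g (⊥ : SimpleGraph (Fin r))) ⊔
    SimpleGraph.fromRel (fun x y => x = Sum.inl c ∧ ∃ i : Fin r, y = Sum.inr i)

/-- The star `S_m` of order `m`, for `m ≥ 1`. -/
def starS (m : ℕ) : SimpleGraph (Fin (m - 1 + 1)) :=
  SimpleGraph.starGraph 0

/-- `U^3_m`, for `m ≥ 3`: a triangle with `m - 3` pendant edges at one of its vertices. -/
def unicyclicU (m : ℕ) : SimpleGraph (Fin 3 ⊕ Fin (m - 3)) :=
  attachPendants (SimpleGraph.cycleGraph 3) 0 (m - 3)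

/-- `B^{3,3}_m`, for `m ≥ 4`: two triangles sharing an edge (that is, `K_4` minus an edge), with
`m - 4` pendant edges at one of the two vertices of degree three. -/
def bicyclicB (m : ℕ) : SimpleGraph (Fin 4 ⊕ Fin (m - 4)) :=
  attachPendants ((⊤ : SimpleGraph (Fin 4)).deleteEdges {s(2, 3)}) 0 (m - 4)

/-- `K_m(m-3,1,1,1)`, for `m ≥ 4`: `K_4` with `m - 4` pendant edges at one vertex. -/
def tricyclicK (m : ℕ) : SimpleGraph (Fin 4 ⊕ Fin (m - 4)) :=
  attachPendants (⊤ : SimpleGraph (Fin 4)) 0 (m - 4)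

/-- `q_m(m-4,1,1,1,1)`, for `m ≥ 5`: three triangles sharing one edge (that is, the join of `K_2`
with three isolated vertices), with `m - 5` pendant edges at one endpoint of the shared edge. -/
def tricyclicQ (m : ℕ) : SimpleGraph ((Fin 2 ⊕ Fin 3) ⊕ Fin (m - 5)) :=
  attachPendants (join (⊤ : SimpleGraph (Fin 2)) (⊥ : SimpleGraph (Fin 3))) (Sum.inl 0) (m - 5)

end ZagrebQuasi

namespace ZagrebQuasi

open Finset

/-! Let H be the `k`-cyclic graph left by deleting p vertices from G. Up to relabelling, G is a
spanning subgraph of H + K_p, and adding edges raises both indices (`firstZagreb_le_of_equiv`,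
`secondZagreb_le_of_equiv`). The indices of H + K_p depend only on the order and size of H, which
are fixed, and increase with M_1(H) and M_2(H). So everything reduces to maximising M_1 and M_2 over
`k`-cyclic graphs of order m = n - p.

There the bounds M_1 ≤ m² - m + k² + 5k and M_2 ≤ m² + 2(k-1)m + c_k follow by induction on m.
Removing a leaf at u changes the indices by amounts governed by d(u) ≤ m - 1 and by the degree sum
over the closed neighbourhood of u, at most 2|E|; the bounds grow by exactly these maxima. If no
leaf remains and m > 1, the degree excesses d(v) - 2 are nonnegative with sum 2(k-1), and a direct
estimate finishes.

Pendants at a universal vertex give equality in every leaf step, so sharpness need only be checked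
on the small cores; the star is computed directly. Membership in the class comes from counting
non-adjacent pairs. -/

/-- The indicator of adjacency, as an integer. -/
noncomputable def adjInd {V : Type*} (G : SimpleGraph V) (x y : V) : ℤ :=
  open Classical in if G.Adj x y then 1 else 0

/-- The degree of a vertex, as an integer. -/
noncomputable def intDegree {V : Type*} [Fintype V] (G : SimpleGraph V) (x : V) : ℤ :=
  ∑ y, adjInd G x y

/-! ### Degrees and Zagreb indices as integer sums over vertices and ordered pairs. -/

section Basic

variable {V : Type*} (G : SimpleGraph V)

theorem adjInd_of_adj {x y : V} (h : G.Adj x y) : adjInd G x y = 1 := if_pos h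

theorem adjInd_of_not_adj {x y : V} (h : ¬ G.Adj x y) : adjInd G x y = 0 := if_neg h

theorem adjInd_self (x : V) : adjInd G x x = 0 := adjInd_of_not_adj G (G.loopless.irrefl x)

theorem adjInd_comm (x y : V) : adjInd G x y = adjInd G y x := by
  by_cases h : G.Adj x y
  · rw [adjInd_of_adj G h, adjInd_of_adj G h.symm]
  · rw [adjInd_of_not_adj G h, adjInd_of_not_adj G fun h' => h h'.symm]

theorem adjInd_nonneg (x y : V) : 0 ≤ adjInd G x y := by
  unfold adjInd; split_ifs <;> norm_num

theorem adjInd_le_one (x y : V) : adjInd G x y ≤ 1 := by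
  unfold adjInd; split_ifs <;> norm_num

theorem adjInd_induce (s : Set V) (x y : s) : adjInd (G.induce s) x y = adjInd G x y := rfl

variable [Fintype V]

theorem intDegree_nonneg (x : V) : 0 ≤ intDegree G x :=
  sum_nonneg fun y _ => adjInd_nonneg G x y

theorem cast_degree [DecidableRel G.Adj] (x : V) : (G.degree x : ℤ) = intDegree G x := by
  classical
  rw [intDegree, ← G.card_neighborFinset_eq_degree, G.neighborFinset_eq_filter, card_filter]
  push_cast
  exact sum_congr rfl fun y _ => by simp only [adjInd]; congr

theorem cast_firstZagreb : (firstZagreb G : ℤ) = ∑ x, intDegree G x ^ 2 := by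
  classical
  simp only [firstZagreb, Nat.cast_sum, Nat.cast_pow, cast_degree]

/-- Every edge carries exactly two darts; summing over darts turns edge sums into double sums over
vertices. -/
theorem two_mul_sum_edgeFinset [DecidableRel G.Adj] (f : Sym2 V → ℤ) :
    2 * ∑ e ∈ G.edgeFinset, f e = ∑ x, ∑ y, adjInd G x y * f s(x, y) := by
  classical
  have h1 : ∑ d : G.Dart, f d.edge = 2 * ∑ e ∈ G.edgeFinset, f e := by
    rw [← sum_fiberwise_of_maps_to (s := univ) (t := G.edgeFinset) (g := fun d : G.Dart => d.edge)
      (fun d _ => by rw [SimpleGraph.mem_edgeFinset]; exact d.edge_mem), mul_sum]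
    refine sum_congr rfl fun e he => ?_
    rw [sum_congr rfl (g := fun _ => f e) (fun d hd => by rw [(mem_filter.1 hd).2]), sum_const,
      G.dart_edge_fiber_card e (SimpleGraph.mem_edgeFinset.1 he)]
    simp
  rw [← h1, ← Fintype.sum_prod_type']
  have h2 : ∀ q : V × V, adjInd G q.1 q.2 * f s(q.1, q.2)
      = if G.Adj q.1 q.2 then f s(q.1, q.2) else 0 := by
    intro q
    by_cases h : G.Adj q.1 q.2 <;> simp [adjInd, h]
  simp only [h2]
  rw [← sum_filter]
  exact sum_bij' (fun d _ => (d.fst, d.snd)) (fun q h => ⟨q, (mem_filter.1 h).2⟩)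
    (by simp) (by simp) (by simp) (by simp) (fun d _ => rfl)

theorem two_mul_secondZagreb :
    2 * (secondZagreb G : ℤ)
      = ∑ x, ∑ y, adjInd G x y * (intDegree G x * intDegree G y) := by
  classical
  rw [secondZagreb, Nat.cast_sum, two_mul_sum_edgeFinset G]
  refine sum_congr rfl fun x _ => sum_congr rfl fun y _ => ?_
  rw [Sym2.lift_mk, Nat.cast_mul, cast_degree, cast_degree]

theorem two_mul_ncard_edgeSet :
    2 * (G.edgeSet.ncard : ℤ) = ∑ x, intDegree G x := by
  classical
  have h := two_mul_sum_edgeFinset G (fun _ => 1)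
  rw [← SimpleGraph.coe_edgeFinset, Set.ncard_coe_finset]
  simpa [intDegree] using h

theorem intDegree_le (x : V) : intDegree G x ≤ Fintype.card V - 1 := by
  classical
  have := G.degree_lt_card_verts x
  rw [← cast_degree G x]
  omega

end Basic

/-! ### Effect of removing a leaf `v` with neighbour `u`. -/

section Leaf

variable {V : Type*} [Fintype V] (G : SimpleGraph V)

theorem sum_compl_singleton (v : V) [Fintype ({v}ᶜ : Set V)] (f : V → ℤ) :
    ∑ x : ({v}ᶜ : Set V), f x = ∑ x, f x - f v := by
  classical
  rw [eq_sub_iff_add_eq, ← sum_erase_add univ f (mem_univ v)]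
  congr 1
  exact (sum_subtype (univ.erase v) (by simp) f).symm

theorem intDegree_induce_compl_singleton (v : V) [Fintype ({v}ᶜ : Set V)]
    (x : ({v}ᶜ : Set V)) :
    intDegree (G.induce {v}ᶜ) x = intDegree G x - adjInd G x v := by
  simp only [intDegree, adjInd_induce]
  exact sum_compl_singleton v (adjInd G x)

variable {G} {u v : V}

theorem intDegree_leaf
    (hv : ∀ x, adjInd G x v = open Classical in if x = u then 1 else 0) :
    intDegree G v = 1 := by
  classical
  simp [intDegree, adjInd_comm G v, hv]

/-- The degree of `u` drops by one, costing 2d(u) - 1, and the leaf itself contributes 1. -/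
theorem firstZagreb_of_leaf [Fintype ({v}ᶜ : Set V)]
    (hv : ∀ x, adjInd G x v = open Classical in if x = u then 1 else 0) :
    (firstZagreb G : ℤ) = firstZagreb (G.induce {v}ᶜ) + 2 * intDegree G u := by
  classical
  rw [cast_firstZagreb, cast_firstZagreb]
  simp only [intDegree_induce_compl_singleton]
  rw [sum_compl_singleton v (fun x => (intDegree G x - adjInd G x v) ^ 2)]
  simp only [adjInd_self, intDegree_leaf hv, hv]
  have : ∀ x, (intDegree G x - if x = u then 1 else 0) ^ 2
      = intDegree G x ^ 2 - if x = u then 2 * intDegree G u - 1 else 0 := by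
    intro x
    split_ifs with h
    · subst h; ring
    · ring
  simp only [this, sum_sub_distrib, sum_ite_eq', mem_univ, if_true]
  ring

/-- The edge `uv` contributes d(u), and each other edge `uy` loses d(y). The sum over neighbours of
`u` also counts `v`, of degree 1, hence the 1 on the left. -/
theorem secondZagreb_of_leaf [Fintype ({v}ᶜ : Set V)]
    (hv : ∀ x, adjInd G x v = open Classical in if x = u then 1 else 0) :
    (secondZagreb G : ℤ) + 1 = secondZagreb (G.induce {v}ᶜ) + intDegree G u
      + ∑ y, adjInd G u y * intDegree G y := by
  classical
  have h := two_mul_secondZagreb G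
  have h' := two_mul_secondZagreb (G.induce {v}ᶜ)
  simp only [intDegree_induce_compl_singleton, adjInd_induce] at h'
  -- In row `x` the leaf lowers only the factor d(u), costing `adjInd G x u`; dropping column `v`
  -- costs `adjInd G x v`.
  have inner : ∀ x : V, ∑ y : ({v}ᶜ : Set V), adjInd G x y *
        ((intDegree G x - adjInd G x v) * (intDegree G y - adjInd G y v))
      = (intDegree G x - adjInd G x v) *
        (∑ y, adjInd G x y * intDegree G y - adjInd G x u - adjInd G x v) := by
    intro x
    rw [sum_compl_singleton v (fun y => adjInd G x y *
        ((intDegree G x - adjInd G x v) * (intDegree G y - adjInd G y v)))]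
    rw [intDegree_leaf hv, adjInd_self]
    have : ∀ y, adjInd G x y * ((intDegree G x - adjInd G x v) * (intDegree G y - adjInd G y v))
      = (intDegree G x - adjInd G x v) * (adjInd G x y * intDegree G y)
        - if y = u then (intDegree G x - adjInd G x v) * adjInd G x u else 0 := by
      intro y
      rw [hv y]
      split_ifs with h
      · subst h; ring
      · ring
    simp only [this, sum_sub_distrib, sum_ite_eq', mem_univ, if_true, ← mul_sum]
    ring
  simp only [inner] at h'
  rw [sum_compl_singleton v (fun x => (intDegree G x - adjInd G x v) *
        (∑ y, adjInd G x y * intDegree G y - adjInd G x u - adjInd G x v))] at h'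
  have hvu : adjInd G v u = 1 := by rw [adjInd_comm, hv]; simp
  have hvsum : ∑ y, adjInd G v y * intDegree G y = intDegree G u := by
    simp [adjInd_comm G v, hv]
  have e1 : ∀ x, (intDegree G x - adjInd G x v) *
        (∑ y, adjInd G x y * intDegree G y - adjInd G x u - adjInd G x v)
      = (∑ y, adjInd G x y * (intDegree G x * intDegree G y)
          - adjInd G u x * intDegree G x)
        - if x = u then (intDegree G u + ∑ y, adjInd G u y * intDegree G y - 1) else 0 := by
    intro x
    have : ∑ y, adjInd G x y * (intDegree G x * intDegree G y)
        = intDegree G x * ∑ y, adjInd G x y * intDegree G y := by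
      rw [mul_sum]; exact sum_congr rfl fun y _ => by ring
    rw [hv x, this, adjInd_comm G u x]
    split_ifs with h
    · subst h; rw [adjInd_self]; ring
    · ring
  rw [sum_congr rfl fun x _ => e1 x] at h'
  simp only [sum_sub_distrib, sum_ite_eq', mem_univ, if_true] at h'
  rw [hvsum, adjInd_self, hvu, intDegree_leaf hv] at h'
  linarith

theorem ncard_edgeSet_of_leaf [Fintype ({v}ᶜ : Set V)]
    (hv : ∀ x, adjInd G x v = open Classical in if x = u then 1 else 0) :
    (G.edgeSet.ncard : ℤ) = (G.induce {v}ᶜ).edgeSet.ncard + 1 := by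
  classical
  have h := two_mul_ncard_edgeSet G
  have h' := two_mul_ncard_edgeSet (G.induce {v}ᶜ)
  simp only [intDegree_induce_compl_singleton] at h'
  rw [sum_compl_singleton v (fun x => intDegree G x - adjInd G x v), sum_sub_distrib,
    adjInd_self, intDegree_leaf hv] at h'
  simp only [hv, sum_ite_eq', mem_univ, if_true] at h'
  linarith

end Leaf

/-! ### Sharp bounds for `k`-cyclic graphs, `k ≤ 3`. -/

section Bounds

variable {V : Type u} [Fintype V] (G : SimpleGraph V)

/-- The left side sums degrees over the closed neighbourhood of `u`, a part of the total degree sum.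
-/
theorem intDegree_add_sum_le (u : V) :
    intDegree G u + ∑ y, adjInd G u y * intDegree G y ≤ 2 * (G.edgeSet.ncard : ℤ) := by
  classical
  rw [two_mul_ncard_edgeSet]
  have : intDegree G u = ∑ y, if y = u then intDegree G y else 0 := by simp
  rw [this, ← sum_add_distrib]
  refine sum_le_sum fun y _ => ?_
  split_ifs with h
  · subst h; simp [adjInd_self]
  · nlinarith [intDegree_nonneg G y, adjInd_le_one G u y]

/-- The constant term of the largest second Zagreb index `m² + 2(k-1)m + c` of a `k`-cyclic
graph of order `m`, for `k ≤ 3`. -/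
def secondZagrebShift : ℕ → ℤ
  | 0 => 1
  | 1 => 3
  | 2 => 9
  | _ => 22

variable {G}

/-- The Zagreb bounds for graphs of minimum degree at least two. -/
theorem zagreb_le_of_two_le_degree {k : ℕ} (hk : k ≤ 3)
    (he : (G.edgeSet.ncard : ℤ) = Fintype.card V - 1 + k) (hV : 0 < Fintype.card V)
    (hd : ∀ v, 2 ≤ intDegree G v) :
    (firstZagreb G : ℤ) ≤ (Fintype.card V : ℤ) ^ 2 - Fintype.card V + k ^ 2 + 5 * k ∧
    (secondZagreb G : ℤ) ≤ (Fintype.card V : ℤ) ^ 2 + 2 * (k - 1) * Fintype.card V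
      + secondZagrebShift k := by
  classical
  set m : ℤ := (Fintype.card V : ℤ) with hm
  have hm0 : 0 < m := Nat.cast_pos.2 hV
  -- Degree excess over 2; both indices become expressions in the `x v`, whose total is fixed by the
  -- edge count.
  set x : V → ℤ := fun v => intDegree G v - 2 with hx
  have hx0 : ∀ v, 0 ≤ x v := fun v => sub_nonneg.2 (hd v)
  have hdx : ∀ v, intDegree G v = 2 + x v := fun v => by simp [hx]
  have hE := two_mul_ncard_edgeSet G
  have hcard : ∑ _v : V, (2 : ℤ) = 2 * m := by simp [hm, mul_comm]
  have hX : ∑ v, x v = 2 * (k - 1) := by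
    simp only [hx, sum_sub_distrib, hcard]
    linarith
  set q := ∑ v, x v ^ 2 with hq
  -- Since d(v) ≤ m - 1, each excess is at most m - 3.
  have hqle : q ≤ 2 * (k - 1) * (m - 3) := by
    rw [← hX, sum_mul, hq]
    refine sum_le_sum fun v _ => ?_
    have := intDegree_le G v
    have h2 := hdx v
    nlinarith [hx0 v]
  have hq0 : 0 ≤ q := sum_nonneg fun v _ => sq_nonneg _
  have hX0 : 0 ≤ ∑ v, x v := sum_nonneg fun v _ => hx0 v
  have hM1 : (firstZagreb G : ℤ) = 4 * m + 8 * (k - 1) + q := by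
    rw [cast_firstZagreb]
    have : ∀ v, intDegree G v ^ 2 = 2 * 2 + 4 * x v + x v ^ 2 := fun v => by rw [hdx]; ring
    simp only [this, sum_add_distrib, ← mul_sum]
    rw [hX, hcard]
    ring
  -- Off-diagonal products total (∑ x)² - ∑ x²; adjacency selects some of these nonnegative terms.
  have hxx : ∑ v, ∑ w, adjInd G v w * (x v * x w) ≤ (2 * (k - 1)) ^ 2 - q := by
    have : (2 * ((k : ℤ) - 1)) ^ 2 - q = ∑ v, ∑ w, (x v * x w - if w = v then x v ^ 2 else 0) := by
      simp only [sum_sub_distrib, sum_ite_eq', mem_univ, if_true]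
      rw [← hX, sq, sum_mul_sum]
    rw [this]
    refine sum_le_sum fun v _ => sum_le_sum fun w _ => ?_
    split_ifs with h
    · subst h; rw [adjInd_self]; nlinarith
    · nlinarith [mul_nonneg (hx0 v) (hx0 w), adjInd_le_one G v w]
  have hxd : ∑ v, ∑ w, adjInd G v w * x v = 4 * (k - 1) + q := by
    have : ∀ v, ∑ w, adjInd G v w * x v = 2 * x v + x v ^ 2 := fun v => by
      rw [← sum_mul]; change intDegree G v * x v = _; rw [hdx]; ring
    simp only [this, sum_add_distrib, ← mul_sum]
    rw [hX]; ring
  have hxd' : ∑ v, ∑ w, adjInd G v w * x w = 4 * (k - 1) + q := by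
    rw [sum_comm, ← hxd]
    exact sum_congr rfl fun v _ => sum_congr rfl fun w _ => by rw [adjInd_comm]
  have hM2 : 2 * (secondZagreb G : ℤ) = 8 * (m - 1 + k) + 4 * (4 * (k - 1) + q)
      + ∑ v, ∑ w, adjInd G v w * (x v * x w) := by
    rw [two_mul_secondZagreb]
    have : ∀ v w, adjInd G v w * (intDegree G v * intDegree G w)
        = 4 * adjInd G v w + 2 * (adjInd G v w * x v) + 2 * (adjInd G v w * x w)
          + adjInd G v w * (x v * x w) := fun v w => by rw [hdx v, hdx w]; ring
    simp only [this, sum_add_distrib, ← mul_sum]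
    rw [hxd, hxd']
    have : ∑ v, ∑ w, adjInd G v w = 2 * (m - 1 + k) := by rw [← he, hE]; rfl
    rw [this]; ring
  -- A simple graph has at most m(m-1)/2 edges; this forces m ≥ 3 for k = 1 and m ≥ 4 for k = 2, 3.
  have hle : 2 * (m - 1 + k) ≤ m * (m - 1) := by
    rw [← he, hE]
    calc ∑ v, intDegree G v ≤ ∑ _v : V, (m - 1) := sum_le_sum fun v _ => intDegree_le G v
      _ = m * (m - 1) := by rw [sum_const, card_univ, nsmul_eq_mul]
  interval_cases k <;> simp only [secondZagrebShift] <;> push_cast at * <;> norm_num at *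
  -- For k = 0 the nonnegative excesses would sum to -2.
  · omega
  · have : 3 ≤ m := by nlinarith
    constructor <;> nlinarith
  · have : 4 ≤ m := by nlinarith
    constructor <;> nlinarith
  · have : 4 ≤ m := by nlinarith
    -- This is the exact slack in the M_1 estimate for k = 3. It is nonnegative only because m is an
    -- integer.
    have : 0 ≤ (m - 4) * (m - 5) := by
      rcases this.eq_or_lt with h | h
      · simp [← h]
      · exact mul_nonneg (by omega) (by omega)
    constructor <;> nlinarith

/-- A connected graph with more than one vertex and a vertex of degree less than two
has a leaf. -/
theorem exists_leaf_of_degree_lt_two [Nontrivial V] (hG : G.Connected) {v : V}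
    (hv : intDegree G v < 2) :
    (G.induce {v}ᶜ).Connected ∧
      ∃ u, ∀ x, adjInd G x v = open Classical in if x = u then 1 else 0 := by
  classical
  have hpos := hG.preconnected.degree_pos_of_nontrivial v
  rw [← cast_degree] at hv
  have h1 : G.degree v = 1 := by omega
  refine ⟨hG.induce_compl_singleton_of_degree_eq_one h1, ?_⟩
  obtain ⟨u, hu, huniq⟩ := SimpleGraph.degree_eq_one_iff_existsUnique_adj.1 h1
  refine ⟨u, fun x => ?_⟩
  split_ifs with h
  · subst h; exact adjInd_of_adj G hu.symm
  · exact adjInd_of_not_adj G fun hx => h (huniq x hx.symm)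

/-- Upper bounds for the Zagreb indices of a `k`-cyclic graph, `k ≤ 3`. -/
theorem zagreb_le_of_isCyclicOfNumber {k : ℕ} (hk : k ≤ 3) (hG : IsCyclicOfNumber k G) :
    (firstZagreb G : ℤ) ≤ (Fintype.card V : ℤ) ^ 2 - Fintype.card V + k ^ 2 + 5 * k ∧
    (secondZagreb G : ℤ) ≤ (Fintype.card V : ℤ) ^ 2 + 2 * (k - 1) * Fintype.card V
      + secondZagrebShift k := by
  classical
  induction hm : Fintype.card V using Nat.strong_induction_on generalizing V with
  | _ m ih =>
  subst hm
  obtain ⟨hc, hcyc⟩ := hG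
  have he : (G.edgeSet.ncard : ℤ) = Fintype.card V - 1 + k := by
    rw [cyclomaticNumber, Nat.card_eq_fintype_card] at hcyc; linarith
  have hne : Nonempty V := hc.nonempty
  by_cases hd : ∀ v, 2 ≤ intDegree G v
  · exact zagreb_le_of_two_le_degree hk he Fintype.card_pos hd
  push Not at hd
  obtain ⟨v, hv⟩ := hd
  rcases subsingleton_or_nontrivial V with hs | hs
  · have h0 : ∀ x, intDegree G x = 0 := fun x => by
      have h1 := intDegree_le G x
      have h2 : Fintype.card V = 1 := Fintype.card_eq_one_iff.2 ⟨v, fun y => hs.elim y v⟩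
      rw [h2] at h1
      exact le_antisymm (by simpa using h1) (intDegree_nonneg G x)
    have h1 := cast_firstZagreb G
    have h2 := two_mul_secondZagreb G
    have h3 := two_mul_ncard_edgeSet G
    have h4 : Fintype.card V = 1 := Fintype.card_eq_one_iff.2 ⟨v, fun y => hs.elim y v⟩
    simp only [h0, mul_zero, sum_const_zero] at h1 h2 h3
    -- A single vertex has no edges, so its cyclomatic number is 0.
    have hk0 : k = 0 := by omega
    subst hk0
    simp at h1 h2
    simp [h4, h1, h2, secondZagrebShift]
  · obtain ⟨hc', u, hu⟩ := exists_leaf_of_degree_lt_two hc hv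
    have hcard : Fintype.card ({v}ᶜ : Set V) = Fintype.card V - 1 := by
      rw [Fintype.card_compl_set]; simp
    have hlt : 1 < Fintype.card V := Fintype.one_lt_card
    have hcardz : ((Fintype.card ({v}ᶜ : Set V) : ℕ) : ℤ) = Fintype.card V - 1 := by omega
    have he' := ncard_edgeSet_of_leaf hu
    obtain ⟨i1, i2⟩ := ih (Fintype.card ({v}ᶜ : Set V)) (by omega) (G := G.induce {v}ᶜ)
      ⟨hc', by rw [cyclomaticNumber, Nat.card_eq_fintype_card]; linarith⟩ rfl
    rw [hcardz] at i1 i2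
    have z1 := firstZagreb_of_leaf hu
    have z2 := secondZagreb_of_leaf hu
    have b1 := intDegree_le G u
    have b2 := intDegree_add_sum_le G u
    -- From order m - 1 to m the bounds grow by 2(m-1) and 2(m-1+k) - 1, exactly the largest
    -- increments allowed by `b1` and `b2`.
    constructor <;> nlinarith

end Bounds

/-! ### Monotonicity under adding edges. -/

section Compare

variable {V W : Type*} [Fintype V] [Fintype W] {G : SimpleGraph V} {H : SimpleGraph W}

theorem intDegree_le_of_equiv (φ : W ≃ V) (h : ∀ x y, G.Adj (φ x) (φ y) → H.Adj x y) (x : W) :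
    intDegree G (φ x) ≤ intDegree H x := by
  rw [intDegree, ← φ.sum_comp]
  refine sum_le_sum fun y _ => ?_
  by_cases hxy : G.Adj (φ x) (φ y)
  · rw [adjInd_of_adj G hxy, adjInd_of_adj H (h x y hxy)]
  · rw [adjInd_of_not_adj G hxy]; exact adjInd_nonneg H x y

theorem firstZagreb_le_of_equiv (φ : W ≃ V) (h : ∀ x y, G.Adj (φ x) (φ y) → H.Adj x y) :
    firstZagreb G ≤ firstZagreb H := by
  zify
  rw [cast_firstZagreb, cast_firstZagreb, ← φ.sum_comp]
  exact sum_le_sum fun x _ =>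
    pow_le_pow_left₀ (intDegree_nonneg G _) (intDegree_le_of_equiv φ h x) 2

theorem secondZagreb_le_of_equiv (φ : W ≃ V) (h : ∀ x y, G.Adj (φ x) (φ y) → H.Adj x y) :
    secondZagreb G ≤ secondZagreb H := by
  suffices 2 * (secondZagreb G : ℤ) ≤ 2 * secondZagreb H by omega
  rw [two_mul_secondZagreb, two_mul_secondZagreb, ← φ.sum_comp]
  refine sum_le_sum fun x _ => ?_
  rw [← φ.sum_comp]
  refine sum_le_sum fun y _ => ?_
  have hx := intDegree_le_of_equiv φ h x
  have hy := intDegree_le_of_equiv φ h y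
  have hd : intDegree G (φ x) * intDegree G (φ y) ≤ intDegree H x * intDegree H y :=
    mul_le_mul hx hy (intDegree_nonneg G _) (intDegree_nonneg H _)
  by_cases hxy : G.Adj (φ x) (φ y)
  · rw [adjInd_of_adj G hxy, adjInd_of_adj H (h x y hxy)]; linarith
  · rw [adjInd_of_not_adj G hxy, zero_mul]
    exact mul_nonneg (adjInd_nonneg H x y)
      (mul_nonneg (intDegree_nonneg H _) (intDegree_nonneg H _))

end Compare

/-! ### The indices of a join with a complete graph. -/

section Join

variable {V : Type*} (H : SimpleGraph V) (p : ℕ)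

theorem joinComplete_adj_inl_inl {x y : V} :
    (joinComplete H p).Adj (Sum.inl x) (Sum.inl y) ↔ H.Adj x y := by
  simp [joinComplete, join]

theorem joinComplete_adj_inl_inr {x : V} {i : Fin p} :
    (joinComplete H p).Adj (Sum.inl x) (Sum.inr i) := by
  simp [joinComplete, join]

theorem joinComplete_adj_inr_inr {i j : Fin p} :
    (joinComplete H p).Adj (Sum.inr i) (Sum.inr j) ↔ i ≠ j := by
  simp [joinComplete, join]

theorem adjInd_joinComplete_inl_inl (x y : V) :
    adjInd (joinComplete H p) (Sum.inl x) (Sum.inl y) = adjInd H x y := by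
  classical
  simp only [adjInd, joinComplete_adj_inl_inl]

theorem adjInd_joinComplete_inl_inr (x : V) (i : Fin p) :
    adjInd (joinComplete H p) (Sum.inl x) (Sum.inr i) = 1 :=
  adjInd_of_adj _ (joinComplete_adj_inl_inr H p)

theorem adjInd_joinComplete_inr_inl (x : V) (i : Fin p) :
    adjInd (joinComplete H p) (Sum.inr i) (Sum.inl x) = 1 :=
  adjInd_of_adj _ (joinComplete_adj_inl_inr H p).symm

theorem adjInd_joinComplete_inr_inr (i j : Fin p) :
    adjInd (joinComplete H p) (Sum.inr i) (Sum.inr j) = 1 - if i = j then 1 else 0 := by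
  by_cases h : i = j
  · subst h; simp [adjInd_self]
  · rw [adjInd_of_adj _ ((joinComplete_adj_inr_inr H p).2 h)]; simp [h]

theorem isUniversal_joinComplete {H : SimpleGraph V} {c : V} (hc : H.IsUniversal c) :
    (joinComplete H p).IsUniversal (Sum.inl c) := by
  rintro (x | i) hx
  · exact (joinComplete_adj_inl_inl H p).2 (hc fun h => hx (by rw [h]))
  · exact joinComplete_adj_inl_inr H p

variable [Fintype V]

theorem intDegree_joinComplete_inl (x : V) :
    intDegree (joinComplete H p) (Sum.inl x) = intDegree H x + p := by
  simp [intDegree, Fintype.sum_sum_type, adjInd_joinComplete_inl_inl, adjInd_joinComplete_inl_inr]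

theorem intDegree_joinComplete_inr (i : Fin p) :
    intDegree (joinComplete H p) (Sum.inr i) = Fintype.card V + p - 1 := by
  simp [intDegree, Fintype.sum_sum_type, adjInd_joinComplete_inr_inl, adjInd_joinComplete_inr_inr]
  ring

theorem two_mul_ncard_edgeSet_joinComplete :
    2 * ((joinComplete H p).edgeSet.ncard : ℤ)
      = 2 * (H.edgeSet.ncard : ℤ) + 2 * p * Fintype.card V + p * (p - 1) := by
  rw [two_mul_ncard_edgeSet, two_mul_ncard_edgeSet]
  simp [Fintype.sum_sum_type, intDegree_joinComplete_inl, intDegree_joinComplete_inr,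
    sum_add_distrib]
  ring

theorem firstZagreb_joinComplete :
    (firstZagreb (joinComplete H p) : ℤ) = firstZagreb H + 4 * p * H.edgeSet.ncard
      + Fintype.card V * (p : ℤ) ^ 2 + p * ((Fintype.card V : ℤ) + p - 1) ^ 2 := by
  have h := two_mul_ncard_edgeSet H
  rw [cast_firstZagreb, cast_firstZagreb]
  simp only [Fintype.sum_sum_type, intDegree_joinComplete_inl, intDegree_joinComplete_inr,
    add_sq, sum_add_distrib, ← sum_mul, ← mul_sum, ← h]
  simp
  ring

/-- Besides order and size, `H` enters only through its two indices, with nonnegative coefficients,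
so maximising over the join reduces to maximising over `H`. -/
theorem secondZagreb_joinComplete :
    2 * (secondZagreb (joinComplete H p) : ℤ) = 2 * secondZagreb H + 2 * p * firstZagreb H
      + 2 * (p : ℤ) ^ 2 * H.edgeSet.ncard
      + 2 * p * ((Fintype.card V : ℤ) + p - 1) * (2 * H.edgeSet.ncard + p * Fintype.card V)
      + p * (p - 1) * ((Fintype.card V : ℤ) + p - 1) ^ 2 := by
  have h := two_mul_ncard_edgeSet H
  have hE : ∑ x, ∑ y, adjInd H x y = 2 * (H.edgeSet.ncard : ℤ) := h.symm
  have hx : ∑ x, (∑ y, adjInd H x y) * intDegree H x = firstZagreb H := by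
    rw [cast_firstZagreb]
    exact sum_congr rfl fun x _ => (sq _).symm
  have hy : ∑ x, ∑ y, adjInd H x y * intDegree H y = firstZagreb H := by
    rw [sum_comm, ← hx]
    simp only [sum_mul]
    exact sum_congr rfl fun x _ => sum_congr rfl fun y _ => by rw [adjInd_comm]
  have hxy : ∀ x y, adjInd H x y * ((intDegree H x + p) * (intDegree H y + p))
      = adjInd H x y * (intDegree H x * intDegree H y) + p * (adjInd H x y * intDegree H x)
        + p * (adjInd H x y * intDegree H y) + (p : ℤ) ^ 2 * adjInd H x y :=
    fun x y => by ring
  rw [two_mul_secondZagreb, two_mul_secondZagreb]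
  simp only [Fintype.sum_sum_type, intDegree_joinComplete_inl, intDegree_joinComplete_inr,
    adjInd_joinComplete_inl_inl, adjInd_joinComplete_inl_inr, adjInd_joinComplete_inr_inl,
    adjInd_joinComplete_inr_inr, hxy, sum_add_distrib, ← mul_sum, hx, hy, hE, one_mul,
    ← sum_mul, ← h, sum_const, sum_sub_distrib, sum_ite_eq, mem_univ, if_true, card_univ,
    Fintype.card_fin, nsmul_eq_mul, mul_one]
  ring

end Join

/-! ### Membership of the joins, and reduction to `k`-cyclic graphs. -/

section Extremal

/-- Deleting vertices does not increase the number of non-adjacent pairs. -/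
theorem edges_deleteVerts_ge {V : Type*} [Fintype V] (G : SimpleGraph V) (S : Finset V) :
    ((Fintype.card V : ℤ) - S.card) * (Fintype.card V - S.card - 1)
      - Fintype.card V * (Fintype.card V - 1) + 2 * G.edgeSet.ncard
      ≤ 2 * ((deleteVerts G S).edgeSet.ncard : ℤ) := by
  classical
  have hsum : ∀ f : V → ℤ, ∑ x : ((S : Set V)ᶜ : Set V), f x = ∑ x ∈ Sᶜ, f x := fun f =>
    (sum_subtype Sᶜ (by simp) f).symm
  have hind : ∀ x : V, ∑ y, (1 - (if y = x then 1 else 0) - adjInd G x y)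
      = Fintype.card V - 1 - intDegree G x := fun x => by
    simp [sum_sub_distrib, intDegree]
  -- The summand indicates an ordered pair of distinct non-adjacent vertices.
  have key : ∑ x ∈ Sᶜ, ∑ y ∈ Sᶜ, (1 - (if y = x then 1 else 0) - adjInd G x y)
      ≤ ∑ x, ∑ y, (1 - (if y = x then 1 else 0) - adjInd G x y) := by
    have hnn : ∀ x y : V, (0 : ℤ) ≤ 1 - (if y = x then 1 else 0) - adjInd G x y := by
      intro x y
      split_ifs with h
      · subst h; simp [adjInd_self]
      · linarith [adjInd_le_one G x y]
    exact (sum_le_sum fun x _ => sum_le_sum_of_subset_of_nonneg (subset_univ _)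
        fun y _ _ => hnn x y).trans
      (sum_le_sum_of_subset_of_nonneg (subset_univ _) fun x _ _ => sum_nonneg fun y _ => hnn x y)
  have hL : ∑ x ∈ Sᶜ, ∑ y ∈ Sᶜ, (1 - (if y = x then 1 else 0) - adjInd G x y)
      = ((Fintype.card V : ℤ) - S.card) * (Fintype.card V - S.card - 1)
        - 2 * ((deleteVerts G S).edgeSet.ncard : ℤ) := by
    have hE : 2 * ((deleteVerts G S).edgeSet.ncard : ℤ) = ∑ x ∈ Sᶜ, ∑ y ∈ Sᶜ, adjInd G x y := by
      rw [two_mul_ncard_edgeSet, ← hsum]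
      exact sum_congr rfl fun x _ => hsum (adjInd G x)
    have hc : ((Sᶜ.card : ℕ) : ℤ) = Fintype.card V - S.card := by
      rw [card_compl, Nat.cast_sub (card_le_univ S)]
    rw [hE]
    simp only [sum_sub_distrib, sum_const, nsmul_eq_mul, hc, mul_one]
    have : ∑ x ∈ Sᶜ, ∑ y ∈ Sᶜ, (if y = x then (1 : ℤ) else 0) = Fintype.card V - S.card := by
      rw [← hc, card_eq_sum_ones, Nat.cast_sum]
      exact sum_congr rfl fun x hx => by rw [sum_ite_eq', if_pos hx]; rfl
    rw [this]; ring
  have hR : ∑ x, ∑ y, (1 - (if y = x then 1 else 0) - adjInd G x y)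
      = (Fintype.card V : ℤ) * (Fintype.card V - 1) - 2 * G.edgeSet.ncard := by
    simp only [hind]
    rw [sum_sub_distrib, ← two_mul_ncard_edgeSet]
    simp
    ring
  rw [hL, hR] at key
  linarith

variable {W : Type*} [Fintype W] {K : SimpleGraph W} {c : W} {n p k : ℕ}

/-- The number of edges of a `k`-cyclic graph. -/
theorem IsCyclicOfNumber.ncard_edgeSet {V : Type*} [Fintype V] {G : SimpleGraph V}
    (h : IsCyclicOfNumber k G) : (G.edgeSet.ncard : ℤ) = Fintype.card V - 1 + k := by
  have := h.2
  rw [cyclomaticNumber, Nat.card_eq_fintype_card] at this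
  linarith

theorem isCyclicOfNumber_deleteVerts_joinComplete {W : Type*} {K : SimpleGraph W}
    {p k : ℕ} (hK : IsCyclicOfNumber k K) :
    IsCyclicOfNumber k (deleteVerts (joinComplete K p) (univ.map Function.Embedding.inr)) := by
  classical
  let e : W ≃ (((univ.map Function.Embedding.inr : Finset (W ⊕ Fin p)) : Set (W ⊕ Fin p))ᶜ :
      Set (W ⊕ Fin p)) :=
    { toFun := fun w => ⟨Sum.inl w, by simp⟩
      invFun := fun x => match x with
        | ⟨Sum.inl w, _⟩ => w
        | ⟨Sum.inr i, h⟩ => absurd (by simp) h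
      left_inv := fun w => rfl
      right_inv := by
        rintro ⟨x | i, h⟩
        · rfl
        · exact absurd (by simp) h }
  let φ : K ≃g deleteVerts (joinComplete K p) (univ.map Function.Embedding.inr) :=
    ⟨e, fun {x y} => joinComplete_adj_inl_inl K p⟩
  refine ⟨φ.connected_iff.1 hK.1, ?_⟩
  rw [← hK.2, cyclomaticNumber, cyclomaticNumber, Nat.card_congr e.symm,
    ← Nat.card_coe_set_eq, ← Nat.card_coe_set_eq, Nat.card_congr φ.mapEdgeSet]

/-- All non-adjacent pairs of the join lie in `K`. Deleting t fewer than p vertices leaves at least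
|E(K)| + tw + t(t-1)/2 edges, where w is the order of `K`, while a `k`-cyclic graph of that order
has |E(K)| + t; this is impossible for w ≥ 2. -/
theorem memQuasiCyclic_joinComplete (hc : K.IsUniversal c) (hn : p + Fintype.card W = n)
    (hW : 2 ≤ Fintype.card W) (he : (K.edgeSet.ncard : ℤ) = Fintype.card W - 1 + k) :
    MemQuasiCyclic p k n (joinComplete K p) := by
  have hK : IsCyclicOfNumber k K := ⟨.of_isUniversal hc, by
    rw [cyclomaticNumber, Nat.card_eq_fintype_card]; linarith⟩
  refine ⟨by simp; omega, .of_isUniversal (isUniversal_joinComplete p hc),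
    ⟨_, by simp, isCyclicOfNumber_deleteVerts_joinComplete hK⟩, fun S hS hcyc => ?_⟩
  classical
  have h1 := edges_deleteVerts_ge (joinComplete K p) S
  have h2 := two_mul_ncard_edgeSet_joinComplete K p
  have h3 := hcyc.ncard_edgeSet
  have h4 : (Fintype.card ((S : Set (W ⊕ Fin p))ᶜ : Set (W ⊕ Fin p)) : ℤ)
      = Fintype.card W + p - S.card := by
    rw [Fintype.card_compl_set, Nat.cast_sub (by simpa using card_le_univ S)]
    simp
  have h5 : (Fintype.card (W ⊕ Fin p) : ℤ) = Fintype.card W + p := by simp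
  rw [h5] at h1
  rw [h4] at h3
  obtain ⟨t, ht, htp⟩ : ∃ t : ℤ, (p : ℤ) = S.card + t ∧ 1 ≤ t := ⟨p - S.card, by ring, by omega⟩
  have hW' : (2 : ℤ) ≤ Fintype.card W := by exact_mod_cast hW
  rw [ht] at h1 h2 h3
  nlinarith

/-- If `K` is `k`-cyclic and attains the largest Zagreb indices among `k`-cyclic graphs of its
order, then so does `K + K_p` in `Q_pC^k(n)`. -/
theorem zagreb_le_of_memQuasiCyclic (hk : k ≤ 3) (hn : p + Fintype.card W = n)
    (he : (K.edgeSet.ncard : ℤ) = Fintype.card W - 1 + k)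
    (h1 : (firstZagreb K : ℤ) = (Fintype.card W : ℤ) ^ 2 - Fintype.card W + k ^ 2 + 5 * k)
    (h2 : (secondZagreb K : ℤ) = (Fintype.card W : ℤ) ^ 2 + 2 * (k - 1) * Fintype.card W
      + secondZagrebShift k)
    {V : Type*} [Fintype V] {G : SimpleGraph V} (hG : MemQuasiCyclic p k n G) :
    firstZagreb G ≤ firstZagreb (joinComplete K p) ∧
      secondZagreb G ≤ secondZagreb (joinComplete K p) := by
  classical
  obtain ⟨hV, -, ⟨S, hS, hcyc⟩, -⟩ := hG
  have hcard : Fintype.card ((S : Set V)ᶜ : Set V) = Fintype.card W := by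
    rw [Fintype.card_compl_set]; simp; omega
  obtain ⟨b1, b2⟩ := zagreb_le_of_isCyclicOfNumber hk hcyc
  have heH := hcyc.ncard_edgeSet
  rw [hcard, ← h1] at b1
  rw [hcard, ← h2] at b2
  rw [hcard, ← he] at heH
  -- Label `S` by `Fin p`; `G` then lacks at most some of the join's edges meeting `S`.
  let φ : ((S : Set V)ᶜ : Set V) ⊕ Fin p ≃ V :=
    (Equiv.sumCongr (Equiv.refl _) (S.equivFinOfCardEq hS).symm).trans
      ((Equiv.sumComm _ _).trans (Equiv.Set.sumCompl (S : Set V)))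
  have hφ : ∀ x y, G.Adj (φ x) (φ y) → (joinComplete (deleteVerts G S) p).Adj x y := by
    rintro (x | i) (y | j) h
    · exact (joinComplete_adj_inl_inl _ p).2 h
    · exact joinComplete_adj_inl_inr _ p
    · exact (joinComplete_adj_inl_inr _ p).symm
    · refine (joinComplete_adj_inr_inr _ p).2 ?_
      rintro rfl
      exact G.loopless.irrefl _ h
  constructor
  · refine (firstZagreb_le_of_equiv φ hφ).trans ?_
    zify
    rw [firstZagreb_joinComplete, firstZagreb_joinComplete, hcard, heH]
    linarith
  · refine (secondZagreb_le_of_equiv φ hφ).trans ?_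
    have z1 := secondZagreb_joinComplete (deleteVerts G S) p
    have z2 := secondZagreb_joinComplete K p
    rw [hcard, heH] at z1
    have : (p : ℤ) * firstZagreb (deleteVerts G S) ≤ p * firstZagreb K :=
      mul_le_mul_of_nonneg_left b1 (by positivity)
    zify
    linarith

end Extremal

/-! ### Universal vertices. -/

section Universal

variable {V : Type*} {H : SimpleGraph V} {c : V}

theorem adjInd_of_isUniversal (hc : H.IsUniversal c) (y : V) :
    adjInd H c y = 1 - open Classical in if y = c then 1 else 0 := by
  classical
  by_cases h : y = c
  · subst h; simp [adjInd_self]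
  · rw [adjInd_of_adj H (hc fun h' => h h'.symm)]; simp [h]

variable [Fintype V]

theorem intDegree_of_isUniversal (hc : H.IsUniversal c) :
    intDegree H c = Fintype.card V - 1 := by
  classical
  simp [intDegree, adjInd_of_isUniversal hc]

/-- Equality case of `intDegree_add_sum_le`: the closed neighbourhood is the whole graph. -/
theorem sum_adjInd_mul_of_isUniversal (hc : H.IsUniversal c) :
    ∑ y, adjInd H c y * intDegree H y = 2 * H.edgeSet.ncard - (Fintype.card V - 1) := by
  classical
  simp [adjInd_of_isUniversal hc, sub_mul, two_mul_ncard_edgeSet,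
    intDegree_of_isUniversal hc]

end Universal

/-! ### Effect of attaching pendant edges. -/

section Pendants

variable {V : Type*} (H : SimpleGraph V) (c : V) (r : ℕ)

theorem attachPendants_adj_inl_inl {x y : V} :
    (attachPendants H c r).Adj (Sum.inl x) (Sum.inl y) ↔ H.Adj x y := by
  simp [attachPendants]

theorem attachPendants_adj_inl_inr {x : V} {i : Fin r} :
    (attachPendants H c r).Adj (Sum.inl x) (Sum.inr i) ↔ x = c := by
  simp [attachPendants]

theorem not_attachPendants_adj_inr_inr {i j : Fin r} :
    ¬ (attachPendants H c r).Adj (Sum.inr i) (Sum.inr j) := by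
  simp [attachPendants]

theorem isUniversal_attachPendants {H : SimpleGraph V} {c : V} (hc : H.IsUniversal c) :
    (attachPendants H c r).IsUniversal (Sum.inl c) := by
  rintro (x | i) hx
  · exact (attachPendants_adj_inl_inl H c r).2 (hc fun h => hx (by rw [h]))
  · exact (attachPendants_adj_inl_inr H c r).2 rfl

theorem adjInd_attachPendants_inl_inl (x y : V) :
    adjInd (attachPendants H c r) (Sum.inl x) (Sum.inl y) = adjInd H x y := by
  classical
  simp only [adjInd, attachPendants_adj_inl_inl]

theorem adjInd_attachPendants_inl_inr (x : V) (i : Fin r) :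
    adjInd (attachPendants H c r) (Sum.inl x) (Sum.inr i)
      = open Classical in if x = c then 1 else 0 := by
  classical
  simp only [adjInd, attachPendants_adj_inl_inr]

theorem adjInd_attachPendants_inr_inl (x : V) (i : Fin r) :
    adjInd (attachPendants H c r) (Sum.inr i) (Sum.inl x)
      = open Classical in if x = c then 1 else 0 := by
  rw [adjInd_comm, adjInd_attachPendants_inl_inr]

theorem adjInd_attachPendants_inr_inr (i j : Fin r) :
    adjInd (attachPendants H c r) (Sum.inr i) (Sum.inr j) = 0 :=
  adjInd_of_not_adj _ (not_attachPendants_adj_inr_inr H c r)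

variable [Fintype V]

theorem intDegree_attachPendants_inl (x : V) :
    intDegree (attachPendants H c r) (Sum.inl x)
      = intDegree H x + open Classical in if x = c then (r : ℤ) else 0 := by
  classical
  simp [intDegree, Fintype.sum_sum_type, adjInd_attachPendants_inl_inl,
    adjInd_attachPendants_inl_inr]

theorem intDegree_attachPendants_inr (i : Fin r) :
    intDegree (attachPendants H c r) (Sum.inr i) = 1 := by
  classical
  simp [intDegree, Fintype.sum_sum_type, adjInd_attachPendants_inr_inl,
    adjInd_attachPendants_inr_inr]

theorem ncard_edgeSet_attachPendants :
    ((attachPendants H c r).edgeSet.ncard : ℤ) = H.edgeSet.ncard + r := by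
  classical
  have h := two_mul_ncard_edgeSet H
  have h' := two_mul_ncard_edgeSet (attachPendants H c r)
  simp [Fintype.sum_sum_type, intDegree_attachPendants_inl, intDegree_attachPendants_inr,
    sum_add_distrib] at h'
  linarith

theorem firstZagreb_attachPendants :
    (firstZagreb (attachPendants H c r) : ℤ)
      = firstZagreb H + 2 * r * intDegree H c + (r : ℤ) ^ 2 + r := by
  classical
  rw [cast_firstZagreb, cast_firstZagreb]
  have : ∀ x, (intDegree H x + if x = c then (r : ℤ) else 0) ^ 2
      = intDegree H x ^ 2 + if x = c then 2 * r * intDegree H c + (r : ℤ) ^ 2 else 0 := by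
    intro x
    split_ifs with h
    · subst h; ring
    · ring
  simp [Fintype.sum_sum_type, intDegree_attachPendants_inl, intDegree_attachPendants_inr,
    sum_add_distrib, this]
  ring

theorem secondZagreb_attachPendants :
    (secondZagreb (attachPendants H c r) : ℤ)
      = secondZagreb H + r * ∑ y, adjInd H c y * intDegree H y + r * (intDegree H c + r) := by
  classical
  have h := two_mul_secondZagreb H
  have h' := two_mul_secondZagreb (attachPendants H c r)
  have inner : ∀ x, ∑ y, adjInd H x y * ((intDegree H x + if x = c then (r : ℤ) else 0) *
        (intDegree H y + if y = c then (r : ℤ) else 0))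
      = ∑ y, adjInd H x y * (intDegree H x * intDegree H y)
        + r * (adjInd H c x * intDegree H x)
        + if x = c then r * ∑ y, adjInd H c y * intDegree H y else 0 := by
    intro x
    have : ∀ y, adjInd H x y * ((intDegree H x + if x = c then (r : ℤ) else 0) *
          (intDegree H y + if y = c then (r : ℤ) else 0))
        = adjInd H x y * (intDegree H x * intDegree H y)
          + (if y = c then r * (adjInd H c x * intDegree H x) else 0)
          + if x = c then r * (adjInd H c y * intDegree H y) else 0 := by
      intro y
      rw [adjInd_comm H c x]
      by_cases hx : x = c <;> by_cases hy : y = c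
      · subst hx; subst hy; simp [adjInd_self]
      · subst hx; simp [hy]; ring
      · subst hy; simp [hx]; ring
      · simp [hx, hy]
    simp only [this, sum_add_distrib, sum_ite_eq', mem_univ, if_true]
    split_ifs with hx
    · rw [mul_sum]
    · simp
  simp only [Fintype.sum_sum_type, intDegree_attachPendants_inl, intDegree_attachPendants_inr,
    adjInd_attachPendants_inl_inl, adjInd_attachPendants_inl_inr, adjInd_attachPendants_inr_inl,
    adjInd_attachPendants_inr_inr, inner, sum_add_distrib] at h'
  simp [← mul_sum] at h'
  linarith

end Pendants

/-! ### The extremal graphs and their cores. -/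

section Values

/-- This and the next two lemmas pass to decidable natural-number sums, so that the small cores can
be settled by `decide`. -/
theorem firstZagreb_of_sum_degree {V : Type*} [Fintype V] (G : SimpleGraph V)
    [DecidableRel G.Adj] {a : ℕ} (h : ∑ v, G.degree v ^ 2 = a) : firstZagreb G = a := by
  rw [← h]
  zify
  simp only [cast_firstZagreb, cast_degree]

theorem ncard_edgeSet_of_sum_degree {V : Type*} [Fintype V] (G : SimpleGraph V)
    [DecidableRel G.Adj] {e : ℕ} (h : ∑ v, G.degree v = 2 * e) : G.edgeSet.ncard = e := by
  have h' := two_mul_ncard_edgeSet G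
  zify at h
  simp only [cast_degree] at h
  omega

theorem secondZagreb_of_sum_degree {V : Type*} [Fintype V] (G : SimpleGraph V)
    [DecidableRel G.Adj] {a : ℕ}
    (h : ∑ x, ∑ y, (if G.Adj x y then G.degree x * G.degree y else 0) = 2 * a) :
    secondZagreb G = a := by
  have h' := two_mul_secondZagreb G
  zify at h
  simp only [cast_degree] at h
  have : ∑ x, ∑ y, adjInd G x y * (intDegree G x * intDegree G y)
      = ∑ x, ∑ y, (if G.Adj x y then intDegree G x * intDegree G y else 0) :=
    sum_congr rfl fun x _ => sum_congr rfl fun y _ => by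
      by_cases hxy : G.Adj x y <;> simp [adjInd, hxy]
  omega

/-- The graph `H` has order `m`, universal vertex `c`, and `m - 1 + k` edges, and its first Zagreb
index attains the upper bound for `k`-cyclic graphs of order `m`. -/
structure IsFirstExtremal {V : Type*} [Fintype V] (k m : ℕ) (H : SimpleGraph V) (c : V) :
    Prop where
  card_eq : Fintype.card V = m
  isUniversal : H.IsUniversal c
  ncard_edgeSet : (H.edgeSet.ncard : ℤ) = m - 1 + k
  firstZagreb_eq : (firstZagreb H : ℤ) = (m : ℤ) ^ 2 - m + k ^ 2 + 5 * k

/-- In addition, the second Zagreb index attains the upper bound. -/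
structure IsExtremal {V : Type*} [Fintype V] (k m : ℕ) (H : SimpleGraph V) (c : V) : Prop
    extends IsFirstExtremal k m H c where
  secondZagreb_eq : (secondZagreb H : ℤ) = (m : ℤ) ^ 2 + 2 * (k - 1) * m + secondZagrebShift k

variable {V : Type*} [Fintype V] {H : SimpleGraph V} {c : V} {k m : ℕ}

/-- A pendant at a universal vertex realises the maximal increment, and the vertex stays universal.
-/
theorem IsFirstExtremal.attachPendants (h : IsFirstExtremal k m H c) (r : ℕ) :
    IsFirstExtremal k (m + r) (attachPendants H c r) (Sum.inl c) where
  card_eq := by simp [h.card_eq]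
  isUniversal := isUniversal_attachPendants r h.isUniversal
  ncard_edgeSet := by
    rw [ncard_edgeSet_attachPendants, h.ncard_edgeSet]; push_cast; ring
  firstZagreb_eq := by
    rw [firstZagreb_attachPendants, h.firstZagreb_eq, intDegree_of_isUniversal h.isUniversal,
      h.card_eq]
    push_cast; ring

theorem IsExtremal.attachPendants (h : IsExtremal k m H c) (r : ℕ) :
    IsExtremal k (m + r) (attachPendants H c r) (Sum.inl c) where
  toIsFirstExtremal := h.toIsFirstExtremal.attachPendants r
  secondZagreb_eq := by
    rw [secondZagreb_attachPendants, h.secondZagreb_eq,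
      sum_adjInd_mul_of_isUniversal h.isUniversal, intDegree_of_isUniversal h.isUniversal,
      h.card_eq, h.ncard_edgeSet]
    push_cast; ring

theorem isExtremal_starS (m : ℕ) (hm : 1 ≤ m) : IsExtremal 0 m (starS m) 0 := by
  have hc : (starS m).IsUniversal 0 := SimpleGraph.isUniversal_starGraph_self
  -- Truncated subtraction: this needs `1 ≤ m`.
  have hcard : Fintype.card (Fin (m - 1 + 1)) = m := by simp; omega
  have hmz : ((m - 1 : ℕ) : ℤ) = m - 1 := by omega
  have h0 : intDegree (starS m) 0 = m - 1 := by
    rw [intDegree_of_isUniversal hc, hcard]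
  have h1 : ∀ i : Fin (m - 1), intDegree (starS m) i.succ = 1 := fun i => by
    rw [starS, ← cast_degree]
    exact_mod_cast SimpleGraph.degree_starGraph_of_ne_center (Fin.succ_ne_zero i)
  have he := two_mul_ncard_edgeSet (starS m)
  have hz := cast_firstZagreb (starS m)
  have hs := two_mul_secondZagreb (starS m)
  have a0 : ∀ i : Fin (m - 1), adjInd (starS m) 0 i.succ = 1 := fun i =>
    adjInd_of_adj _ (hc (Fin.succ_ne_zero i).symm)
  have a1 : ∀ i : Fin (m - 1), adjInd (starS m) i.succ 0 = 1 := fun i => by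
    rw [adjInd_comm, a0]
  have a2 : ∀ i j : Fin (m - 1), adjInd (starS m) i.succ j.succ = 0 := fun i j =>
    adjInd_of_not_adj _ (by simp [starS])
  simp only [Fin.sum_univ_succ, h0, h1, a0, a1, a2, adjInd_self, sum_const, card_univ,
    Fintype.card_fin, nsmul_eq_mul, hmz] at he hz hs
  refine ⟨⟨hcard, hc, ?_, ?_⟩, ?_⟩
  · push_cast; linarith
  · push_cast; linarith
  · simp only [secondZagrebShift]; push_cast; linarith

theorem isExtremal_cycleGraph_three : IsExtremal 1 3 (SimpleGraph.cycleGraph 3) 0 where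
  card_eq := rfl
  isUniversal := fun {w} => by revert w; decide
  ncard_edgeSet := by rw [ncard_edgeSet_of_sum_degree (e := 3) _ (by decide)]; norm_num
  firstZagreb_eq := by rw [firstZagreb_of_sum_degree (a := 12) _ (by decide)]; norm_num
  secondZagreb_eq := by
    rw [secondZagreb_of_sum_degree (a := 12) _ (by decide)]; norm_num [secondZagrebShift]

theorem isExtremal_diamond :
    IsExtremal 2 4 ((⊤ : SimpleGraph (Fin 4)).deleteEdges {s(2, 3)}) 0 where
  card_eq := rfl
  isUniversal := fun {w} => by revert w; decide
  ncard_edgeSet := by rw [ncard_edgeSet_of_sum_degree (e := 5) _ (by decide)]; norm_num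
  firstZagreb_eq := by rw [firstZagreb_of_sum_degree (a := 26) _ (by decide)]; norm_num
  secondZagreb_eq := by
    rw [secondZagreb_of_sum_degree (a := 33) _ (by decide)]; norm_num [secondZagrebShift]

theorem isExtremal_top_four : IsExtremal 3 4 (⊤ : SimpleGraph (Fin 4)) 0 where
  card_eq := rfl
  isUniversal := fun {w} => by revert w; decide
  ncard_edgeSet := by rw [ncard_edgeSet_of_sum_degree (e := 6) _ (by decide)]; norm_num
  firstZagreb_eq := by rw [firstZagreb_of_sum_degree (a := 36) _ (by decide)]; norm_num
  secondZagreb_eq := by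
    rw [secondZagreb_of_sum_degree (a := 54) _ (by decide)]; norm_num [secondZagrebShift]

instance : DecidableRel (join (⊤ : SimpleGraph (Fin 2)) (⊥ : SimpleGraph (Fin 3))).Adj :=
  fun x y => decidable_of_iff (x ≠ y ∧ (x.isLeft ∨ y.isLeft)) (by
    rcases x with x | x <;> rcases y with y | y <;> simp [join])

/-- Only M_1 is extremal: here M_2 = 64, while the bound at order 5 is 67. -/
theorem isFirstExtremal_book :
    IsFirstExtremal 3 5 (join (⊤ : SimpleGraph (Fin 2)) (⊥ : SimpleGraph (Fin 3)))
      (Sum.inl 0) where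
  card_eq := rfl
  isUniversal := fun {w} => by revert w; decide
  ncard_edgeSet := by rw [ncard_edgeSet_of_sum_degree (e := 7) _ (by decide)]; norm_num
  firstZagreb_eq := by rw [firstZagreb_of_sum_degree (a := 44) _ (by decide)]; norm_num

theorem IsFirstExtremal.memQuasiCyclic {n p : ℕ} (h : IsFirstExtremal k m H c) (hm : 2 ≤ m)
    (hn : p + m = n) : MemQuasiCyclic p k n (joinComplete H p) := by
  obtain ⟨rfl, hc, he, -⟩ := h
  exact memQuasiCyclic_joinComplete hc hn hm he

theorem IsExtremal.zagreb_le {n p : ℕ} (h : IsExtremal k m H c) (hk : k ≤ 3) (hn : p + m = n)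
    {V' : Type*} [Fintype V'] {G : SimpleGraph V'} (hG : MemQuasiCyclic p k n G) :
    firstZagreb G ≤ firstZagreb (joinComplete H p) ∧
      secondZagreb G ≤ secondZagreb (joinComplete H p) := by
  obtain ⟨⟨rfl, hc, he, h1⟩, h2⟩ := h
  exact zagreb_le_of_memQuasiCyclic hk hn he h1 h2 hG

theorem IsFirstExtremal.firstZagreb_joinComplete_eq {W : Type*} [Fintype W] {K : SimpleGraph W}
    {d : W} (h : IsFirstExtremal k m H c) (h' : IsFirstExtremal k m K d) (p : ℕ) :
    firstZagreb (joinComplete H p) = firstZagreb (joinComplete K p) := by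
  zify
  rw [firstZagreb_joinComplete, firstZagreb_joinComplete, h.card_eq, h'.card_eq,
    h.ncard_edgeSet, h'.ncard_edgeSet, h.firstZagreb_eq, h'.firstZagreb_eq]

end Values

end ZagrebQuasi

/-! ### The four cases, from their cores. -/

theorem mainTheorem1 (n p : ℕ) :
    (p + 2 ≤ n →
      ZagrebQuasi.MemQuasiCyclic p 0 n (ZagrebQuasi.joinComplete (ZagrebQuasi.starS (n - p)) p) ∧
      ∀ (V : Type u) [Fintype V] (G : SimpleGraph V), ZagrebQuasi.MemQuasiCyclic p 0 n G →
        ZagrebQuasi.firstZagreb G ≤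
          ZagrebQuasi.firstZagreb (ZagrebQuasi.joinComplete (ZagrebQuasi.starS (n - p)) p) ∧
        ZagrebQuasi.secondZagreb G ≤
          ZagrebQuasi.secondZagreb (ZagrebQuasi.joinComplete (ZagrebQuasi.starS (n - p)) p)) ∧
    (p + 3 ≤ n →
      ZagrebQuasi.MemQuasiCyclic p 1 n
        (ZagrebQuasi.joinComplete (ZagrebQuasi.unicyclicU (n - p)) p) ∧
      ∀ (V : Type u) [Fintype V] (G : SimpleGraph V), ZagrebQuasi.MemQuasiCyclic p 1 n G →
        ZagrebQuasi.firstZagreb G ≤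
          ZagrebQuasi.firstZagreb (ZagrebQuasi.joinComplete (ZagrebQuasi.unicyclicU (n - p)) p) ∧
        ZagrebQuasi.secondZagreb G ≤
          ZagrebQuasi.secondZagreb
            (ZagrebQuasi.joinComplete (ZagrebQuasi.unicyclicU (n - p)) p)) ∧
    (p + 4 ≤ n →
      ZagrebQuasi.MemQuasiCyclic p 2 n
        (ZagrebQuasi.joinComplete (ZagrebQuasi.bicyclicB (n - p)) p) ∧
      ∀ (V : Type u) [Fintype V] (G : SimpleGraph V), ZagrebQuasi.MemQuasiCyclic p 2 n G →
        ZagrebQuasi.firstZagreb G ≤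
          ZagrebQuasi.firstZagreb (ZagrebQuasi.joinComplete (ZagrebQuasi.bicyclicB (n - p)) p) ∧
        ZagrebQuasi.secondZagreb G ≤
          ZagrebQuasi.secondZagreb
            (ZagrebQuasi.joinComplete (ZagrebQuasi.bicyclicB (n - p)) p)) ∧
    (p + 5 ≤ n →
      ZagrebQuasi.MemQuasiCyclic p 3 n
        (ZagrebQuasi.joinComplete (ZagrebQuasi.tricyclicK (n - p)) p) ∧
      ZagrebQuasi.MemQuasiCyclic p 3 n
        (ZagrebQuasi.joinComplete (ZagrebQuasi.tricyclicQ (n - p)) p) ∧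
      ZagrebQuasi.firstZagreb (ZagrebQuasi.joinComplete (ZagrebQuasi.tricyclicK (n - p)) p) =
        ZagrebQuasi.firstZagreb (ZagrebQuasi.joinComplete (ZagrebQuasi.tricyclicQ (n - p)) p) ∧
      ∀ (V : Type u) [Fintype V] (G : SimpleGraph V), ZagrebQuasi.MemQuasiCyclic p 3 n G →
        ZagrebQuasi.firstZagreb G ≤
          ZagrebQuasi.firstZagreb (ZagrebQuasi.joinComplete (ZagrebQuasi.tricyclicK (n - p)) p) ∧
        ZagrebQuasi.secondZagreb G ≤
          ZagrebQuasi.secondZagreb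
            (ZagrebQuasi.joinComplete (ZagrebQuasi.tricyclicK (n - p)) p)) := by
  refine ⟨fun hn => ?_, fun hn => ?_, fun hn => ?_, fun hn => ?_⟩
  · have h := ZagrebQuasi.isExtremal_starS (n - p) (by omega)
    exact ⟨h.memQuasiCyclic (by omega) (by omega),
      fun V _ G hG => h.zagreb_le (by norm_num) (by omega) hG⟩
  · have h := ZagrebQuasi.isExtremal_cycleGraph_three.attachPendants (n - p - 3)
    exact ⟨h.memQuasiCyclic (by omega) (by omega),
      fun V _ G hG => h.zagreb_le (by norm_num) (by omega) hG⟩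
  · have h := ZagrebQuasi.isExtremal_diamond.attachPendants (n - p - 4)
    exact ⟨h.memQuasiCyclic (by omega) (by omega),
      fun V _ G hG => h.zagreb_le (by norm_num) (by omega) hG⟩
  · have h := ZagrebQuasi.isExtremal_top_four.attachPendants (n - p - 4)
    have h' := ZagrebQuasi.isFirstExtremal_book.attachPendants (n - p - 5)
    -- The cores have orders 4 and 5; as n - p ≥ 5, both padded graphs have order n - p.
    rw [show 5 + (n - p - 5) = 4 + (n - p - 4) by omega] at h'
    exact ⟨h.memQuasiCyclic (by omega) (by omega), h'.memQuasiCyclic (by omega) (by omega),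
      h.firstZagreb_joinComplete_eq h' p,
      fun V _ G hG => h.zagreb_le (by norm_num) (by omega) hG⟩
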